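/- Lemma 5.4 (Unit-scale maximal function estimate). Let $R\in\mathbb R$ (the unit-scale case being $R=1$). There exists a constant $C\ge 1$, depending only on $R$, such that the following holds. Let $\psi\in C_c^\infty(\mathbb R^4;\mathbb R)$ with $\operatorname{supp}\psi\subseteq\{|\xi|\le R\}$, let $\{\mathbf e_1,\dots,\mathbf e_4\}$ be an orthonormal basis of $\mathbb R^4$, let $s\in\mathbb R$ and $f\in H^s(\mathbb R^4)$, and let $k\in\mathbb Z^4$ with $|k|\ge 10$, where $|\cdot|$ is the Euclidean norm. With $\hat f(\xi)=\int_{\mathbb R^4}e^{-ix\cdot\xi}f(x)\,dx$ (extended to tempered distributions), put $$P_kf=\mathcal F^{-1}\bigl(\psi(\xi-k)\hat f(\xi)\bigr),\qquad \widehat{e^{it\Delta}h}(\xi)=e^{-it|\xi|^2}\hat h(\xi).$$ Then $P_kf\in L^2(\mathbb R^4)$, the functions $e^{it\Delta}P_kf\in L^2(\mathbb R^4)$, $t\in\mathbb R$, have a representative $(t,x)\mapsto(e^{it\Delta}P_kf)(x)$ that is continuous on $\mathbb R\times\mathbb R^4$, and for each $\ell=1,\dots,4$ $$\bigl\|e^{it\Delta}P_kf\bigr\|_{L^{2,\infty}_{\mathbf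 e_\ell}(\mathbb R\times\mathbb R^4)}\le C\,|k|^{1/2}\,\|P_kf\|_{L^2(\mathbb R^4)}.$$ Here, writing $x=x_\ell\mathbf e_\ell+x'$ with $x'\perp\mathbf e_\ell$, $$\|h\|_{L^{2,\infty}_{\mathbf e_\ell}(\mathbb R\times\mathbb R^4)}=\Bigl(\int_{\mathbb R}\bigl(\operatorname*{ess\,sup}_{t\in\mathbb R,\;x'\in\mathbf e_\ell^\perp}|h(t,x_\ell\mathbf e_\ell+x')|\bigr)^2\,dx_\ell\Bigr)^{1/2}.$$ -/

import Mathlib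

open MeasureTheory
open scoped ENNReal SchwartzMap ContDiff

/-- Four-dimensional Euclidean space. -/
abbrev R4 : Type := EuclideanSpace ℝ (Fin 4)

/-- The lattice point `k ∈ ℤ⁴` as a point of `ℝ⁴`. -/
def latticePoint (k : Fin 4 → ℤ) : R4 := WithLp.toLp 2 (fun i => (k i : ℝ))

/-- The Fourier multiplier operator `m(D)` on tempered distributions, for the convention
`f̂(ξ) = ∫ e^{-i x·ξ} f(x) dx`. Mathlib's Fourier transform is `∫ e^{-2πi x·η} f(x) dx`, so that
`ξ = 2π η`. -/
noncomputable def freqMultiplier (m : R4 → ℂ) (f : 𝓢'(R4, ℂ)) : 𝓢'(R4, ℂ) :=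
  TemperedDistribution.fourierMultiplierCLM ℂ (fun η : R4 => m ((2 * Real.pi) • η)) f

/-- The frequency projection `P_k f = 𝓕⁻¹ (ψ(ξ - k) f̂(ξ))`. -/
noncomputable def unitProj (ψ : R4 → ℝ) (k : Fin 4 → ℤ) (f : 𝓢'(R4, ℂ)) : 𝓢'(R4, ℂ) :=
  freqMultiplier (fun ξ => (ψ (ξ - latticePoint k) : ℂ)) f

/-- The free Schrödinger propagator `e^{itΔ}`, with symbol `e^{-it|ξ|²}`. -/
noncomputable def schrodinger (t : ℝ) (f : 𝓢'(R4, ℂ)) : 𝓢'(R4, ℂ) :=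
  freqMultiplier (fun ξ => Complex.exp (-Complex.I * (t : ℂ) * ((‖ξ‖ ^ 2 : ℝ) : ℂ))) f

/-- The tempered distribution `T` is (integration against) the square integrable function `g`. -/
def IsL2Function (T : 𝓢'(R4, ℂ)) (g : R4 → ℂ) : Prop :=
  ∃ hg : MemLp g 2 (volume : Measure R4), T = ((hg.toLp g : Lp ℂ 2 (volume : Measure R4)) : 𝓢'(R4, ℂ))

/-- The point of `ℝ⁴` with `ℓ`-th coordinate `y` and remaining coordinates `z`, with respect to the
orthonormal basis `e`. -/
noncomputable def lateralPoint (e : OrthonormalBasis (Fin 4) ℝ R4) (ℓ : Fin 4) (y : ℝ)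
    (z : Fin 3 → ℝ) : R4 :=
  y • e ℓ + ∑ j : Fin 3, z j • e (ℓ.succAbove j)

/-- The norm of the lateral space `L^{p,q}_{e_ℓ}(I × ℝ⁴)`: the `L^p` norm in the coordinate along
`e_ℓ` of the `L^q` norm in time and in the three remaining coordinates. -/
noncomputable def lateralNorm (e : OrthonormalBasis (Fin 4) ℝ R4) (ℓ : Fin 4) (p q : ℝ≥0∞)
    (I : Set ℝ) (h : ℝ → R4 → ℂ) : ℝ≥0∞ :=
  eLpNorm (fun y : ℝ =>
    eLpNorm (fun w : ℝ × (Fin 3 → ℝ) => h w.1 (lateralPoint e ℓ y w.2)) q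
      ((volume.restrict I).prod volume)) p volume

/-!
A `T T*` argument with a Gaussian frequency weight.

Write `φ` for the Fourier transform of `P_k f` in Mathlib's variable `η`, where `ξ = 2π η`. It is
square integrable and vanishes unless `|2π η - k| ≤ R`. With `W η = exp (-|2π η - k|² / 2)`, which is
at least `exp (-R² / 2)` there, `φ = W Φ` and `‖Φ‖ ≤ exp (R² / 2) ‖φ‖`; no bound on `ψ` is
involved (`exists_lp_eq_freqGaussian_mul`). Hence `e^{itΔ} P_k f (x) = ⟪V (t, x), Φ⟫`, where
`V (t, x)` is the `L²` function `W` times a unimodular phase (`fourierInv_schrodingerSymbol_mul`).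
As `V` is continuous into `L²`, this representative is jointly continuous.

The Gram kernel of `V` is an explicit Gaussian integral, and its modulus is at most
`1 / (1 + t²) * exp (-|x - 2 t k|² / (4 (1 + t²)))`. If `|k| ≤ κ`, with `κ ≥ 1`, this is bounded,
uniformly in `t` and in the components of `x` orthogonal to the unit vector `e`, by
`1 / (1 + (⟪x, e⟫ / κ)²)` (`norm_gaussianKernel_le_of_inner`), whose integral in `⟪x, e⟫` is `π κ`:
this is the loss of `|k|`.

To pass from the kernel to the maximal function, the supremum over `t` and the transverse variables
is first taken over finitely many points, where a measurable choice `y ↦ p y` of the maximising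
point exists; for each choice the map `Φ ↦ ⟪V (p y), Φ⟫` is bounded from `L²(dη)` to `L²(dy)` by
Schur's test applied to its Gram kernel (`lintegral_enorm_inner_sq_le`). Monotone convergence
gives the supremum over a countable dense set (`lintegral_iSup_enorm_inner_sq_le`), and continuity
gives the full supremum.
-/

open scoped FourierTransform

/-! ### The `T T*` principle for maximal functions -/

/-- The quadratic form version of Schur's test for a symmetric nonnegative kernel. -/
lemma lintegral_lintegral_mul_mul_le {Y : Type*} [MeasurableSpace Y] {ν : Measure Y} [SFinite ν]
    {h : Y → ℝ≥0∞} (hh : Measurable h) {q : Y → Y → ℝ≥0∞} (hq : Measurable (Function.uncurry q))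
    (hsymm : ∀ y y', q y y' = q y' y) {A : ℝ≥0∞} (hA : ∀ y, ∫⁻ y', q y y' ∂ν ≤ A) :
    ∫⁻ y, h y * ∫⁻ y', h y' * q y y' ∂ν ∂ν ≤ A * ∫⁻ y, h y ^ 2 ∂ν := by
  have hq1 : ∀ y, Measurable (q y) := fun y => hq.comp (measurable_const.prodMk measurable_id)
  have amgm : ∀ a b c : ℝ≥0∞, 2 * (a * (b * c)) ≤ a ^ 2 * c + b ^ 2 * c := by
    intro a b c
    calc 2 * (a * (b * c)) = (2 * a * b) * c := by ring
      _ ≤ (a ^ 2 + b ^ 2) * c := by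
        gcongr
        rcases eq_or_ne a ⊤ with rfl | ha
        · simp
        rcases eq_or_ne b ⊤ with rfl | hb
        · simp
        lift a to NNReal using ha
        lift b to NNReal using hb
        exact_mod_cast two_mul_le_add_sq a b
      _ = _ := by ring
  have h1 : ∫⁻ y, ∫⁻ y', h y ^ 2 * q y y' ∂ν ∂ν ≤ A * ∫⁻ y, h y ^ 2 ∂ν := by
    rw [← lintegral_const_mul _ (hh.pow_const 2)]
    refine lintegral_mono fun y => ?_
    rw [lintegral_const_mul _ (hq1 y), mul_comm]
    gcongr
    exact hA y
  have h2 : ∫⁻ y, ∫⁻ y', h y' ^ 2 * q y y' ∂ν ∂ν = ∫⁻ y, ∫⁻ y', h y ^ 2 * q y y' ∂ν ∂ν := by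
    rw [lintegral_lintegral_swap]
    · simp_rw [hsymm]
    · exact (((hh.comp measurable_snd).pow_const 2).mul hq).aemeasurable
  have h3 : 2 * ∫⁻ y, h y * ∫⁻ y', h y' * q y y' ∂ν ∂ν ≤ 2 * (A * ∫⁻ y, h y ^ 2 ∂ν) := by
    calc 2 * ∫⁻ y, h y * ∫⁻ y', h y' * q y y' ∂ν ∂ν
        = ∫⁻ y, ∫⁻ y', 2 * (h y * (h y' * q y y')) ∂ν ∂ν := by
          rw [← lintegral_const_mul' _ _ (by simp)]
          refine lintegral_congr fun y => ?_
          have hm : Measurable fun y' => h y' * q y y' := hh.mul (hq1 y)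
          rw [← lintegral_const_mul _ hm, ← lintegral_const_mul _ (hm.const_mul _)]
      _ ≤ ∫⁻ y, ∫⁻ y', (h y ^ 2 * q y y' + h y' ^ 2 * q y y') ∂ν ∂ν :=
          lintegral_mono fun y => lintegral_mono fun y' => amgm _ _ _
      _ = ∫⁻ y, ∫⁻ y', h y ^ 2 * q y y' ∂ν ∂ν + ∫⁻ y, ∫⁻ y', h y' ^ 2 * q y y' ∂ν ∂ν := by
          rw [← lintegral_add_left]
          · refine lintegral_congr fun y => ?_
            rw [lintegral_add_left ((hq1 y).const_mul _)]
          · have hm : Measurable fun p : Y × Y => h p.1 ^ 2 * q p.1 p.2 :=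
              ((hh.comp measurable_fst).pow_const 2).mul hq
            exact hm.lintegral_prod_right'
      _ ≤ 2 * (A * ∫⁻ y, h y ^ 2 ∂ν) := by
          rw [h2, two_mul]; gcongr
  exact (ENNReal.mul_le_mul_iff_right (by simp) (by simp)).1 h3

/-- The `T T*` principle: the map `Φ ↦ ⟪V ·, Φ⟫` into `L²(ν)` is bounded as soon as the Gram kernel
`⟪V y, V y'⟫` passes Schur's test. Finiteness of `ν` and boundedness of `V` only serve to make the
dual vector `∫ ⟪V y, Φ⟫ • V y ∂ν` well defined; they do not enter the constant. -/
lemma lintegral_enorm_inner_sq_le {Y H : Type*} [MeasurableSpace Y] {ν : Measure Y}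
    [IsFiniteMeasure ν] [NormedAddCommGroup H] [InnerProductSpace ℂ H] [CompleteSpace H]
    {V : Y → H} (hV : StronglyMeasurable V) {B : ℝ} (hB : ∀ y, ‖V y‖ ≤ B) {A : ℝ≥0∞}
    (hA : ∀ y, ∫⁻ y', ‖inner ℂ (V y) (V y')‖ₑ ∂ν ≤ A) (Φ : H) :
    ∫⁻ y, ‖inner ℂ (V y) Φ‖ₑ ^ 2 ∂ν ≤ A * ‖Φ‖ₑ ^ 2 := by
  set h : Y → ℂ := fun y => inner ℂ (V y) Φ with hdef
  have hm : StronglyMeasurable h := hV.inner stronglyMeasurable_const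
  have hbd : ∀ y, ‖h y‖ ≤ B * ‖Φ‖ := fun y =>
    (norm_inner_le_norm _ _).trans (by gcongr; exact hB y)
  have hint : Integrable (fun y => h y • V y) ν := by
    refine Integrable.of_bound (hm.smul hV).aestronglyMeasurable (B * ‖Φ‖ * B) ?_
    refine Filter.Eventually.of_forall fun y => ?_
    rw [norm_smul]
    gcongr
    · exact (norm_nonneg _).trans (hbd y)
    · exact hbd y
    · exact hB y
  set G : H := ∫ y, h y • V y ∂ν with hG
  set J : ℝ≥0∞ := ∫⁻ y, ‖h y‖ₑ ^ 2 ∂ν with hJ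
  have hJtop : J ≠ ⊤ := by
    have : J ≤ ∫⁻ _, (ENNReal.ofReal (B * ‖Φ‖)) ^ 2 ∂ν := by
      refine lintegral_mono fun y => ?_
      gcongr
      rw [← ofReal_norm]
      exact ENNReal.ofReal_le_ofReal (hbd y)
    refine (this.trans_lt ?_).ne
    rw [lintegral_const]
    exact ENNReal.mul_lt_top (by simp) (measure_lt_top _ _)
  -- `G` is the adjoint applied to `h`, so pairing it with `Φ` gives back `J`
  have hpair : J ≤ ‖Φ‖ₑ * ‖G‖ₑ := by
    have e1 : inner ℂ Φ G = ((∫ y, ‖h y‖ ^ 2 ∂ν : ℝ) : ℂ) := by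
      rw [hG, ← integral_inner hint, ← integral_complex_ofReal]
      refine integral_congr_ae (Filter.Eventually.of_forall fun y => ?_)
      simp only [inner_smul_right]
      rw [← inner_conj_symm, Complex.mul_conj, Complex.normSq_eq_norm_sq]
    have e2 : J = ‖inner ℂ Φ G‖ₑ := by
      rw [e1, ← ofReal_norm, Complex.norm_real, Real.norm_of_nonneg
        (integral_nonneg fun y => by positivity), ofReal_integral_eq_lintegral_ofReal]
      · refine lintegral_congr fun y => ?_
        rw [ENNReal.ofReal_pow (norm_nonneg _), ofReal_norm]
      · refine Integrable.of_bound (hm.norm.pow 2).aestronglyMeasurable ((B * ‖Φ‖) ^ 2) ?_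
        refine Filter.Eventually.of_forall fun y => ?_
        rw [norm_pow, norm_norm]
        gcongr
        exact hbd y
      · exact Filter.Eventually.of_forall fun y => by positivity
    rw [e2, ← ofReal_norm, ← ofReal_norm, ← ofReal_norm, ← ENNReal.ofReal_mul (norm_nonneg _)]
    exact ENNReal.ofReal_le_ofReal (norm_inner_le_norm _ _)
  -- expanding `⟪G, G⟫` produces the Gram kernel
  have hGG : ‖G‖ₑ ^ 2 ≤ A * J := by
    have e0 : ‖G‖ₑ ^ 2 = ‖inner ℂ G G‖ₑ := by
      rw [inner_self_eq_norm_sq_to_K, ← ofReal_norm, ← ofReal_norm]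
      simp [ENNReal.ofReal_pow]
    have e1 : ∀ x : H, ‖inner ℂ x G‖ₑ ≤ ∫⁻ y, ‖h y‖ₑ * ‖inner ℂ x (V y)‖ₑ ∂ν := by
      intro x
      rw [hG, ← integral_inner hint]
      refine (enorm_integral_le_lintegral_enorm _).trans_eq (lintegral_congr fun y => ?_)
      rw [inner_smul_right, enorm_mul]
    calc ‖G‖ₑ ^ 2 ≤ ∫⁻ y, ‖h y‖ₑ * ‖inner ℂ G (V y)‖ₑ ∂ν := e0.trans_le (e1 G)
      _ ≤ ∫⁻ y, ‖h y‖ₑ * ∫⁻ y', ‖h y'‖ₑ * ‖inner ℂ (V y) (V y')‖ₑ ∂ν ∂ν := by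
        refine lintegral_mono fun y => ?_
        gcongr
        refine le_of_eq_of_le ?_ (e1 (V y))
        rw [← ofReal_norm, ← ofReal_norm, norm_inner_symm]
      _ ≤ A * J := by
        refine lintegral_lintegral_mul_mul_le hm.enorm ?_ ?_ hA
        · exact ((hV.comp_measurable measurable_fst).inner
            (hV.comp_measurable measurable_snd)).enorm
        · intro y y'
          rw [← ofReal_norm, ← ofReal_norm, norm_inner_symm]
  -- `J² ≤ ‖Φ‖² ‖G‖² ≤ ‖Φ‖² A J`, and a factor `J` cancels because it is finite
  rcases eq_or_ne J 0 with h0 | h0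
  · rw [h0]; exact zero_le
  have h4 : J * J ≤ J * (A * ‖Φ‖ₑ ^ 2) := by
    calc J * J ≤ (‖Φ‖ₑ * ‖G‖ₑ) * (‖Φ‖ₑ * ‖G‖ₑ) := by gcongr
      _ = ‖Φ‖ₑ ^ 2 * ‖G‖ₑ ^ 2 := by ring
      _ ≤ ‖Φ‖ₑ ^ 2 * (A * J) := by gcongr
      _ = _ := by ring
  exact (ENNReal.mul_le_mul_iff_right h0 hJtop).1 h4

/-- The index of the largest of finitely many measurable functions can be chosen measurably. -/
lemma exists_measurable_forall_le_selection {Y : Type*} [MeasurableSpace Y] {f : ℕ → Y → ℝ≥0∞}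
    (hf : ∀ n, Measurable (f n)) (N : ℕ) :
    ∃ s : Y → ℕ, Measurable s ∧ ∀ y, ∀ n ≤ N, f n y ≤ f (s y) y := by
  induction N with
  | zero => exact ⟨fun _ => 0, measurable_const, fun y n hn => by simp [Nat.le_zero.1 hn]⟩
  | succ N ih =>
    obtain ⟨s, hs, hle⟩ := ih
    have hfs : Measurable fun y => f (s y) y :=
      (measurable_from_prod_countable_right (f := fun p : ℕ × Y => f p.1 p.2) hf).comp
        (hs.prodMk measurable_id)
    classical
    refine ⟨fun y => if f (s y) y < f (N + 1) y then N + 1 else s y,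
      Measurable.ite (measurableSet_lt hfs (hf _)) measurable_const hs, fun y n hn => ?_⟩
    dsimp only
    rcases Nat.le_succ_iff.1 hn with h | rfl
    · split_ifs with hlt
      · exact (hle y n h).trans hlt.le
      · exact hle y n h
    · split_ifs with hlt
      · exact le_rfl
      · exact not_lt.1 hlt

/-- A maximal `T T*` estimate: if the Gram kernels between all the curves `p n` are dominated by a
single kernel `q` passing Schur's test, then the square function of the supremum over `n` obeys the
same bound as each individual curve. -/
lemma lintegral_iSup_enorm_inner_sq_le {Y P H : Type*} [MeasurableSpace Y] {μ : Measure Y}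
    [SigmaFinite μ] [TopologicalSpace P] [MeasurableSpace P] [BorelSpace P]
    [SecondCountableTopology P] [TopologicalSpace.PseudoMetrizableSpace P]
    [NormedAddCommGroup H] [InnerProductSpace ℂ H]
    [CompleteSpace H] {V : P → H} (hV : Continuous V) {B : ℝ} (hB : ∀ p, ‖V p‖ ≤ B)
    {p : ℕ → Y → P} (hp : ∀ n, Measurable (p n)) {q : Y → Y → ℝ≥0∞}
    (hq : ∀ m n y y', ‖inner ℂ (V (p m y)) (V (p n y'))‖ₑ ≤ q y y') {A : ℝ≥0∞}
    (hA : ∀ y, ∫⁻ y', q y y' ∂μ ≤ A) (Φ : H) :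
    ∫⁻ y, ⨆ n, ‖inner ℂ (V (p n y)) Φ‖ₑ ^ 2 ∂μ ≤ A * ‖Φ‖ₑ ^ 2 := by
  set f : ℕ → Y → ℝ≥0∞ := fun n y => ‖inner ℂ (V (p n y)) Φ‖ₑ ^ 2 with hfdef
  have hf : ∀ n, Measurable (f n) := fun n =>
    ((hV.inner continuous_const).enorm.measurable.comp (hp n)).pow_const 2
  choose s hs hle using exists_measurable_forall_le_selection hf
  set S := spanningSets μ
  -- truncating both the supremum and the space reduces the claim to finite measures and a
  -- measurable selection
  set F : ℕ → Y → ℝ≥0∞ := fun N => (S N).indicator (fun y => ⨆ n ≤ N, f n y) with hF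
  have hFm : ∀ N, Measurable (F N) := fun N =>
    (Measurable.iSup fun n => Measurable.iSup fun _ => hf n).indicator
      (measurableSet_spanningSets μ N)
  have hmono : Monotone F := by
    intro M N hMN y
    simp only [hF]
    by_cases hy : y ∈ S M
    · rw [Set.indicator_of_mem hy, Set.indicator_of_mem (monotone_spanningSets μ hMN hy)]
      exact biSup_mono fun n hn => hn.trans hMN
    · rw [Set.indicator_of_notMem hy]; exact zero_le
  have hsup : ∀ y, ⨆ n, f n y ≤ ⨆ N, F N y := by
    intro y
    refine iSup_le fun n => ?_
    obtain ⟨M, hM⟩ : ∃ M, y ∈ S M := by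
      have : y ∈ ⋃ i, S i := by rw [iUnion_spanningSets]; trivial
      simpa using this
    refine le_trans ?_ (le_iSup _ (max n M))
    simp only [hF]
    rw [Set.indicator_of_mem (monotone_spanningSets μ (le_max_right n M) hM)]
    exact le_iSup₂ (f := fun i (_ : i ≤ max n M) => f i y) n (le_max_left n M)
  calc ∫⁻ y, ⨆ n, f n y ∂μ ≤ ∫⁻ y, ⨆ N, F N y ∂μ := lintegral_mono hsup
    _ = ⨆ N, ∫⁻ y, F N y ∂μ := lintegral_iSup hFm hmono
    _ ≤ A * ‖Φ‖ₑ ^ 2 := by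
      refine iSup_le fun N => ?_
      have hps : Measurable fun y => p (s N y) y :=
        (measurable_from_prod_countable_right (f := fun z : ℕ × Y => p z.1 z.2) hp).comp
          ((hs N).prodMk measurable_id)
      have : IsFiniteMeasure (μ.restrict (S N)) :=
        ⟨by simpa using measure_spanningSets_lt_top μ N⟩
      calc ∫⁻ y, F N y ∂μ = ∫⁻ y in S N, ⨆ n ≤ N, f n y ∂μ :=
            lintegral_indicator (measurableSet_spanningSets μ N) _
        _ ≤ ∫⁻ y in S N, ‖inner ℂ (V (p (s N y) y)) Φ‖ₑ ^ 2 ∂μ :=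
            lintegral_mono fun y => iSup₂_le fun n hn => hle N y n hn
        _ ≤ A * ‖Φ‖ₑ ^ 2 := by
            refine lintegral_enorm_inner_sq_le (V := fun y => V (p (s N y) y))
              (hV.comp_stronglyMeasurable hps.stronglyMeasurable) (fun y => hB _) (fun y => ?_) Φ
            exact ((lintegral_mono fun y' => hq _ _ _ _).trans
              (setLIntegral_le_lintegral _ _)).trans (hA y)

/-! ### Gaussian wave packets and their Gram kernel -/

/-- The phase `x · ξ - t |ξ|²` of the free Schrödinger flow at the space-time point `p = (t, x)`, with
`ξ = 2π η`. -/
noncomputable def schrodingerPhase (p : ℝ × R4) (η : R4) : ℝ :=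
  inner ℝ p.2 ((2 * Real.pi) • η) - p.1 * ‖(2 * Real.pi) • η‖ ^ 2

lemma continuous_schrodingerPhase :
    Continuous fun z : (ℝ × R4) × R4 => schrodingerPhase z.1 z.2 := by
  unfold schrodingerPhase
  fun_prop

lemma schrodingerPhase_sub (p p' : ℝ × R4) (η : R4) :
    schrodingerPhase (p - p') η = schrodingerPhase p η - schrodingerPhase p' η := by
  simp only [schrodingerPhase, Prod.fst_sub, Prod.snd_sub, inner_sub_left]
  ring

/-- The Gaussian weight `exp (-|ξ - k|² / 2)`, with `ξ = 2π η`. It replaces a smooth frequency cutoff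
because it makes the kernel below explicit. -/
noncomputable def freqGaussian (k η : R4) : ℝ := Real.exp (-‖(2 * Real.pi) • η - k‖ ^ 2 / 2)

lemma continuous_freqGaussian (k : R4) : Continuous (freqGaussian k) := by
  unfold freqGaussian
  fun_prop

lemma norm_cexp_mul_I_mul (a b : ℝ) : ‖(a : ℂ) * Complex.exp (Complex.I * (b : ℂ))‖ = |a| := by
  rw [norm_mul, mul_comm Complex.I, Complex.norm_exp_ofReal_mul_I, mul_one, Complex.norm_real,
    Real.norm_eq_abs]

/-- The Schrödinger evolution of the squared weight `exp (-|ξ - k|²)`, as an integral in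
`η = ξ / (2π)`, at the space-time point `p = (t, x)`. -/
noncomputable def gaussianKernel (k : R4) (p : ℝ × R4) : ℂ :=
  ∫ η, ((freqGaussian k η ^ 2 : ℝ) : ℂ) * Complex.exp (Complex.I * (schrodingerPhase p η : ℂ))

/-- After the translation `η ↦ η + k / (2π)` the kernel is the Fourier transform of a Gaussian of complex
width, evaluated along the Galilean trajectory `x - 2 t k`. -/
lemma gaussianKernel_eq (k : R4) (p : ℝ × R4) :
    gaussianKernel k p = Complex.exp (Complex.I * ((inner ℝ p.2 k - p.1 * ‖k‖ ^ 2 : ℝ) : ℂ)) *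
      ((Real.pi / (4 * Real.pi ^ 2 * (1 + Complex.I * p.1))) ^ 2 *
        Complex.exp (-‖p.2 - (2 * p.1) • k‖ ^ 2 / (4 * (1 + Complex.I * p.1)))) := by
  obtain ⟨t, x⟩ := p
  have hpi : (Real.pi : ℂ) ≠ 0 := by exact_mod_cast Real.pi_ne_zero
  have h1 : (1 + Complex.I * t : ℂ) ≠ 0 := by
    intro h
    simpa using congrArg Complex.re h
  have hb : 0 < (4 * Real.pi ^ 2 * (1 + Complex.I * t) : ℂ).re := by
    have : (4 * Real.pi ^ 2 * (1 + Complex.I * t) : ℂ) =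
      ((4 * Real.pi ^ 2 : ℝ) : ℂ) * (1 + Complex.I * t) := by push_cast; ring
    rw [this, Complex.re_ofReal_mul]
    simp
    positivity
  have key := GaussianFourier.integral_cexp_neg_mul_sq_norm_add hb
    (2 * Real.pi * Complex.I) (x - (2 * t) • k)
  have e1 : ((Module.finrank ℝ R4 : ℂ) / 2) = ((2 : ℕ) : ℂ) := by
    simp [finrank_euclideanSpace]; norm_num
  rw [e1, Complex.cpow_natCast] at key
  have e2 : (2 * Real.pi * Complex.I) ^ 2 * ‖x - (2 * t) • k‖ ^ 2 /
      (4 * (4 * Real.pi ^ 2 * (1 + Complex.I * t))) =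
      -‖x - (2 * t) • k‖ ^ 2 / (4 * (1 + Complex.I * t)) := by
    rw [mul_pow, Complex.I_sq]
    field_simp
    ring
  rw [e2] at key
  dsimp only
  rw [← key, ← integral_const_mul, gaussianKernel,
    ← integral_add_right_eq_self _ ((2 * Real.pi)⁻¹ • k)]
  refine integral_congr_ae (Filter.Eventually.of_forall fun v => ?_)
  have h2 : (2 * Real.pi) • (v + (2 * Real.pi)⁻¹ • k) = (2 * Real.pi) • v + k := by
    rw [smul_add, smul_smul, mul_inv_cancel₀ (by positivity), one_smul]
  simp only [freqGaussian, schrodingerPhase, h2, add_sub_cancel_right]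
  rw [← Real.exp_nat_mul, Complex.ofReal_exp, ← Complex.exp_add, ← Complex.exp_add]
  congr 1
  rw [norm_add_sq_real, norm_smul, Real.norm_of_nonneg (by positivity)]
  simp only [inner_add_right, inner_sub_left, real_inner_smul_left, real_inner_smul_right]
  rw [real_inner_comm v k]
  push_cast
  ring

/-- Four dimensions give the decay `(1 + t²)⁻¹`, which cancels against the width `1 + t²` of the spatial
Gaussian once `exp (-s)` is bounded by `(1 + s)⁻¹`. -/
lemma norm_gaussianKernel_le (k : R4) (p : ℝ × R4) :
    ‖gaussianKernel k p‖ ≤ (2 * (4 * (1 + p.1 ^ 2) + ‖p.2 - (2 * p.1) • k‖ ^ 2))⁻¹ := by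
  obtain ⟨t, x⟩ := p
  set w := ‖x - (2 * t) • k‖ with hw
  have hns : ‖(1 + Complex.I * t : ℂ)‖ ^ 2 = 1 + t ^ 2 := by
    rw [← Complex.normSq_eq_norm_sq, Complex.normSq_apply]
    simp; ring
  have hre : (-(w : ℂ) ^ 2 / (4 * (1 + Complex.I * t))).re = -(w ^ 2 / (4 * (1 + t ^ 2))) := by
    have : (-(w : ℂ) ^ 2 / (4 * (1 + Complex.I * t))) =
        ((-(w ^ 2 / 4) : ℝ) : ℂ) * (1 + Complex.I * t)⁻¹ := by
      push_cast
      rw [mul_comm (4 : ℂ), ← div_div, div_eq_mul_inv (_ / _), div_eq_mul_inv (-(w : ℂ)^2)]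
      ring
    rw [this, Complex.re_ofReal_mul, Complex.inv_re, Complex.normSq_eq_norm_sq, hns]
    simp
    field_simp
  rw [gaussianKernel_eq]
  dsimp only
  rw [norm_mul, norm_mul, mul_comm Complex.I, Complex.norm_exp_ofReal_mul_I, one_mul, norm_pow,
    norm_div, norm_mul, div_pow, mul_pow, hns, Complex.norm_exp, ← hw, hre]
  have hpi := Real.pi_gt_three
  have h4 : ‖(4 * Real.pi ^ 2 : ℂ)‖ = 4 * Real.pi ^ 2 := by
    rw [← Complex.ofReal_ofNat, ← Complex.ofReal_pow, ← Complex.ofReal_mul, Complex.norm_real,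
      Real.norm_of_nonneg (by positivity)]
  rw [h4, Complex.norm_real, Real.norm_of_nonneg Real.pi_pos.le, Real.exp_neg]
  have h5 : w ^ 2 / (4 * (1 + t ^ 2)) + 1 ≤ Real.exp (w ^ 2 / (4 * (1 + t ^ 2))) :=
    Real.add_one_le_exp _
  have h6 : Real.pi ^ 2 / ((4 * Real.pi ^ 2) ^ 2 * (1 + t ^ 2)) ≤ (8 * (1 + t ^ 2))⁻¹ := by
    rw [inv_eq_one_div, div_le_div_iff₀ (by positivity) (by positivity)]
    nlinarith [mul_nonneg (mul_nonneg (sq_nonneg Real.pi) (show 0 ≤ 1 + t ^ 2 by positivity))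
        (show 0 ≤ Real.pi ^ 2 - 1 by nlinarith),
      mul_pos (pow_pos Real.pi_pos 4) (show 0 < 1 + t ^ 2 by positivity)]
  calc _ ≤ (8 * (1 + t ^ 2))⁻¹ * (w ^ 2 / (4 * (1 + t ^ 2)) + 1)⁻¹ := by
        gcongr
    _ = _ := by
        rw [← mul_inv]
        congr 1
        field_simp
        ring

/-- The kernel bound that is uniform in time and in the directions orthogonal to `e`. Either
`x - 2 t k` is large along `e`, or `|⟪x, e⟫| ≲ κ |t|` and the decay in time takes over. -/
lemma norm_gaussianKernel_le_of_inner {k e : R4} (he : ‖e‖ = 1) {κ : ℝ} (hκ : 1 ≤ κ)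
    (hk : ‖k‖ ≤ κ) (p : ℝ × R4) : ‖gaussianKernel k p‖ ≤ (1 + (inner ℝ p.2 e / κ) ^ 2)⁻¹ := by
  refine (norm_gaussianKernel_le k p).trans ?_
  obtain ⟨t, x⟩ := p
  dsimp only
  have hκ0 : 0 < κ := by linarith
  set a := inner ℝ (x - (2 * t) • k) e with ha
  set c := inner ℝ k e with hc
  have h1 : |a| ≤ ‖x - (2 * t) • k‖ := by
    simpa [he] using abs_real_inner_le_norm (x - (2 * t) • k) e
  have h2 : |c| ≤ κ := by
    refine le_trans ?_ hk
    simpa [he] using abs_real_inner_le_norm k e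
  have hy : inner ℝ x e = a + 2 * t * c := by
    rw [ha, inner_sub_left, real_inner_smul_left]; ring
  have h1' : a ^ 2 ≤ ‖x - (2 * t) • k‖ ^ 2 := by rw [← sq_abs]; gcongr
  have h2' : c ^ 2 ≤ κ ^ 2 := by rw [← sq_abs]; gcongr
  have h3 : (inner ℝ x e / κ) ^ 2 ≤ 2 * a ^ 2 + 8 * t ^ 2 := by
    rw [div_pow, div_le_iff₀ (by positivity), hy]
    have : a ^ 2 * 1 ≤ a ^ 2 * κ ^ 2 := by gcongr; nlinarith
    nlinarith [sq_nonneg (a - 2 * t * c), mul_le_mul_of_nonneg_left h2' (sq_nonneg t)]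
  gcongr
  linarith

lemma integrable_freqGaussian_sq (k : R4) : Integrable fun η => freqGaussian k η ^ 2 := by
  have hb : 0 < (4 * Real.pi ^ 2 : ℂ).re := by
    rw [← Complex.ofReal_ofNat, ← Complex.ofReal_pow, ← Complex.ofReal_mul, Complex.ofReal_re]
    positivity
  have h := (GaussianFourier.integrable_cexp_neg_mul_sq_norm_add hb 0 (0 : R4)).norm
  have h' := h.comp_sub_right ((2 * Real.pi)⁻¹ • k)
  refine h'.congr (Filter.Eventually.of_forall fun η => ?_)
  have h2 : (2 * Real.pi) • η - k = (2 * Real.pi) • (η - (2 * Real.pi)⁻¹ • k) := by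
    rw [smul_sub, smul_smul, mul_inv_cancel₀ (by positivity), one_smul]
  simp only [freqGaussian, h2, norm_smul, Real.norm_of_nonneg (show 0 ≤ 2 * Real.pi by positivity)]
  rw [← Real.exp_nat_mul, Complex.norm_exp]
  congr 1
  set v := ‖η - (2 * Real.pi)⁻¹ • k‖
  have : (-(4 * Real.pi ^ 2 : ℂ) * (v : ℂ) ^ 2 +
      0 * ((inner ℝ (0 : R4) (η - (2 * Real.pi)⁻¹ • k) : ℝ) : ℂ)) =
      ((-(4 * Real.pi ^ 2 * v ^ 2) : ℝ) : ℂ) := by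
    push_cast; ring
  rw [this, Complex.ofReal_re]
  push_cast
  ring

lemma continuous_gaussianKernel (k : R4) : Continuous (gaussianKernel k) := by
  unfold gaussianKernel
  refine continuous_of_dominated (F := fun p η => ((freqGaussian k η ^ 2 : ℝ) : ℂ) *
    Complex.exp (Complex.I * (schrodingerPhase p η : ℂ))) (fun p => ?_) (fun p => ?_)
    (integrable_freqGaussian_sq k) (Filter.Eventually.of_forall fun η => ?_)
  · have := continuous_freqGaussian k
    have h2 : Continuous (schrodingerPhase p) :=
      continuous_schrodingerPhase.comp (Continuous.prodMk_right p)
    exact Continuous.aestronglyMeasurable (by fun_prop)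
  · refine Filter.Eventually.of_forall fun η => ?_
    rw [norm_cexp_mul_I_mul, abs_of_nonneg (sq_nonneg _)]
  · have h2 : Continuous fun p => schrodingerPhase p η :=
      continuous_schrodingerPhase.comp (Continuous.prodMk_left η)
    fun_prop

/-- The weight `exp (-|ξ - k|² / 2)` modulated by the conjugate of the Schrödinger phase. The sign is
negative because the inner product of `L²` is conjugate linear in its first argument. -/
noncomputable def wavePacketFun (k : R4) (p : ℝ × R4) (η : R4) : ℂ :=
  (freqGaussian k η : ℂ) * Complex.exp (Complex.I * ((-schrodingerPhase p η : ℝ) : ℂ))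

lemma memLp_wavePacketFun (k : R4) (p : ℝ × R4) : MemLp (wavePacketFun k p) 2 := by
  have hc : Continuous (wavePacketFun k p) := by
    have := continuous_freqGaussian k
    have h2 : Continuous (schrodingerPhase p) :=
      continuous_schrodingerPhase.comp (Continuous.prodMk_right p)
    unfold wavePacketFun
    fun_prop
  rw [memLp_two_iff_integrable_sq_norm hc.aestronglyMeasurable]
  refine (integrable_freqGaussian_sq k).congr (Filter.Eventually.of_forall fun η => ?_)
  simp only [wavePacketFun]
  rw [norm_cexp_mul_I_mul, sq_abs]

/-- The function `wavePacketFun k p` as an element of `L²`. -/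
noncomputable def wavePacket (k : R4) (p : ℝ × R4) : Lp ℂ 2 (volume : Measure R4) :=
  (memLp_wavePacketFun k p).toLp _

/-- Pairing with a wave packet evaluates at `p = (t, x)` the free evolution of the function with Fourier
transform `freqGaussian k * Φ`. -/
lemma inner_wavePacket_eq_integral (k : R4) (p : ℝ × R4) (Φ : Lp ℂ 2 (volume : Measure R4)) :
    inner ℂ (wavePacket k p) Φ = ∫ η, Complex.exp (Complex.I * (schrodingerPhase p η : ℂ)) *
      (freqGaussian k η * Φ η) := by
  rw [L2.inner_def]
  refine integral_congr_ae ?_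
  filter_upwards [(memLp_wavePacketFun k p).coeFn_toLp] with η h
  rw [wavePacket, h, RCLike.inner_apply, wavePacketFun, map_mul, Complex.conj_ofReal,
    ← Complex.exp_conj, map_mul, Complex.conj_I, Complex.conj_ofReal]
  push_cast
  rw [neg_mul_neg]
  ring

lemma inner_wavePacket_wavePacket (k : R4) (p p' : ℝ × R4) :
    inner ℂ (wavePacket k p) (wavePacket k p') = gaussianKernel k (p - p') := by
  rw [inner_wavePacket_eq_integral, gaussianKernel]
  refine integral_congr_ae ?_
  filter_upwards [(memLp_wavePacketFun k p').coeFn_toLp] with η h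
  rw [wavePacket, h, wavePacketFun, schrodingerPhase_sub]
  push_cast
  rw [mul_sub, sub_eq_add_neg, Complex.exp_add, mul_neg]
  ring

/-- Strong continuity follows from continuity of the Gram kernel, since all wave packets have the same
norm. -/
lemma continuous_wavePacket (k : R4) : Continuous (wavePacket k) := by
  rw [continuous_iff_continuousAt]
  intro p
  rw [ContinuousAt, tendsto_iff_norm_sub_tendsto_zero]
  have h : ∀ p', ‖wavePacket k p' - wavePacket k p‖ =
      √(2 * (gaussianKernel k 0).re - 2 * (gaussianKernel k (p' - p)).re) := by
    intro p'
    have hs : ∀ r, ‖wavePacket k r‖ ^ 2 = (gaussianKernel k 0).re := by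
      intro r
      rw [← inner_self_eq_norm_sq (𝕜 := ℂ), inner_wavePacket_wavePacket, sub_self]; rfl
    rw [← Real.sqrt_sq (norm_nonneg (_ - _)), norm_sub_sq (𝕜 := ℂ), hs, hs,
      inner_wavePacket_wavePacket]
    congr 1
    simp only [RCLike.re_eq_complex_re]
    ring
  simp_rw [h]
  have hc : Continuous fun p' =>
      √(2 * (gaussianKernel k 0).re - 2 * (gaussianKernel k (p' - p)).re) := by
    have := continuous_gaussianKernel k
    fun_prop
  simpa using hc.tendsto p

lemma norm_wavePacket (k : R4) (p : ℝ × R4) : ‖wavePacket k p‖ = √(gaussianKernel k 0).re := by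
  rw [← Real.sqrt_sq (norm_nonneg (wavePacket k p)), ← inner_self_eq_norm_sq (𝕜 := ℂ),
    inner_wavePacket_wavePacket, sub_self]
  rfl

/-! ### Frequency projections and the propagator on tempered distributions -/

lemma hasTemperateGrowth_cexp_I_mul (a : ℝ) :
    Function.HasTemperateGrowth fun r : ℝ => Complex.exp (a * Complex.I * r) := by
  have hder : ∀ n : ℕ, iteratedDeriv n (fun r : ℝ => Complex.exp (a * Complex.I * r)) =
      fun r : ℝ => (a * Complex.I) ^ n * Complex.exp (a * Complex.I * r) := by
    intro n
    induction n with
    | zero => simp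
    | succ n ih =>
      rw [iteratedDeriv_succ, ih]
      funext r
      have h1 : HasDerivAt (fun r : ℝ => (a * Complex.I : ℂ) * r) (a * Complex.I * 1) r :=
        (Complex.ofRealCLM.hasDerivAt (x := r)).const_mul _
      rw [(h1.cexp.const_mul _).deriv]
      ring
  refine ⟨?_, fun n => ⟨0, |a| ^ n, fun r => ?_⟩⟩
  · have : ContDiff ℝ ∞ fun r : ℝ => (r : ℂ) := Complex.ofRealCLM.contDiff
    exact Complex.contDiff_exp.comp (contDiff_const.mul this)
  · rw [norm_iteratedFDeriv_eq_norm_iteratedDeriv, hder, norm_mul, norm_pow, norm_mul,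
      Complex.norm_I, Complex.norm_real, mul_right_comm, ← Complex.ofReal_mul,
      Complex.norm_exp_ofReal_mul_I]
    simp

/-- The symbol `e^{-it|ξ|²}` of the propagator in the variable `η = ξ / (2π)`. -/
noncomputable def schrodingerSymbol (t : ℝ) (η : R4) : ℂ :=
  Complex.exp (-Complex.I * (t : ℂ) * ((‖(2 * Real.pi) • η‖ ^ 2 : ℝ) : ℂ))

lemma hasTemperateGrowth_schrodingerSymbol (t : ℝ) :
    Function.HasTemperateGrowth (schrodingerSymbol t) := by
  have h1 : Function.HasTemperateGrowth fun η : R4 => ‖η‖ ^ 2 := by fun_prop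
  have h := (hasTemperateGrowth_cexp_I_mul (-(t * (2 * Real.pi) ^ 2))).comp h1
  convert h using 1
  funext η
  simp only [schrodingerSymbol, Function.comp, norm_smul]
  rw [Real.norm_of_nonneg (by positivity)]
  congr 1
  push_cast
  ring

lemma norm_schrodingerSymbol (t : ℝ) (η : R4) : ‖schrodingerSymbol t η‖ = 1 := by
  rw [schrodingerSymbol, show -Complex.I * (t : ℂ) * ((‖(2 * Real.pi) • η‖ ^ 2 : ℝ) : ℂ) =
    ((-(t * ‖(2 * Real.pi) • η‖ ^ 2) : ℝ) : ℂ) * Complex.I by push_cast; ring,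
    Complex.norm_exp_ofReal_mul_I]

/-- The inverse Fourier transform on `L²`, defined by density, agrees with the absolutely convergent
integral on `L¹ ∩ L²`: both represent the same tempered distribution. -/
lemma coeFn_fourierInv_toLp_ae_eq {φ : R4 → ℂ} (h1 : Integrable φ) (h2 : MemLp φ 2) :
    ((𝓕⁻ (h2.toLp φ) : Lp ℂ 2 (volume : Measure R4)) : R4 → ℂ) =ᵐ[volume] 𝓕⁻ φ := by
  set T : Lp ℂ 2 (volume : Measure R4) := 𝓕⁻ (h2.toLp φ)
  have hTd : 𝓕⁻ ((h2.toLp φ : Lp ℂ 2 (volume : Measure R4)) : 𝓢'(R4, ℂ)) = (T : 𝓢'(R4, ℂ)) :=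
    Lp.fourierInv_toTemperedDistribution_eq _
  have hcont : Continuous (𝓕⁻ φ) := by
    rw [Real.fourierInv_eq_fourier_comp_neg]
    exact VectorFourier.fourierIntegral_continuous Real.continuous_fourierChar
      (innerSL ℝ).continuous₂ h1.comp_neg
  refine ae_eq_of_integral_contDiff_smul_eq ((Lp.memLp T).locallyIntegrable (by norm_num))
    hcont.locallyIntegrable fun g hg hgc => ?_
  have hg₁ : HasCompactSupport (Complex.ofRealCLM ∘ g) := hgc.comp_left rfl
  have hg₂ : ContDiff ℝ ∞ (Complex.ofRealCLM ∘ g) := by fun_prop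
  set G : 𝓢(R4, ℂ) := hg₁.toSchwartzMap hg₂
  have e1 : ∫ x, g x • T x = (T : 𝓢'(R4, ℂ)) G := by
    rw [Lp.toTemperedDistribution_apply]
    rfl
  have e2 : (T : 𝓢'(R4, ℂ)) G = ∫ x, 𝓕⁻ (G : R4 → ℂ) x • φ x := by
    rw [← hTd, TemperedDistribution.fourierInv_apply, Lp.toTemperedDistribution_apply,
      SchwartzMap.fourierInv_coe]
    refine integral_congr_ae ?_
    filter_upwards [h2.coeFn_toLp] with x hx
    rw [hx]
  have hflip : (-(innerₗ R4)).flip = -(innerₗ R4) := by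
    ext x y
    simp [real_inner_comm]
  have e3 : ∫ x, 𝓕⁻ (G : R4 → ℂ) x • φ x = ∫ x, G x • 𝓕⁻ φ x := by
    have h := VectorFourier.integral_fourierIntegral_smul_eq_flip (μ := (volume : Measure R4))
      (ν := (volume : Measure R4)) (L := -(innerₗ R4)) (f := G) (g := φ)
      Real.continuous_fourierChar (by
        have : Continuous fun p : R4 × R4 => -(inner ℝ p.1 p.2 : ℝ) := by fun_prop
        exact this) G.integrable h1
    rw [hflip] at h
    exact h
  rw [e1, e2, e3]
  rfl

lemma isL2Function_fourierInv {φ : R4 → ℂ} (h1 : Integrable φ) (h2 : MemLp φ 2) :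
    IsL2Function (𝓕⁻ ((h2.toLp φ : Lp ℂ 2 (volume : Measure R4)) : 𝓢'(R4, ℂ))) (𝓕⁻ φ) := by
  have hae := coeFn_fourierInv_toLp_ae_eq h1 h2
  have hmem : MemLp (𝓕⁻ φ) 2 := (memLp_congr_ae hae).1 (Lp.memLp _)
  refine ⟨hmem, ?_⟩
  rw [Lp.fourierInv_toTemperedDistribution_eq]
  congr 1
  exact Lp.ext (hae.trans hmem.coeFn_toLp.symm)

lemma eLpNorm_fourierInv {φ : R4 → ℂ} (h1 : Integrable φ) (h2 : MemLp φ 2) :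
    eLpNorm (𝓕⁻ φ) 2 volume = eLpNorm φ 2 volume := by
  rw [← eLpNorm_congr_ae (coeFn_fourierInv_toLp_ae_eq h1 h2), ← eLpNorm_congr_ae h2.coeFn_toLp,
    ← Lp.enorm_def, ← Lp.enorm_def]
  have h : ‖(𝓕⁻ (h2.toLp φ) : Lp ℂ 2 (volume : Measure R4))‖ = ‖h2.toLp φ‖ :=
    (Lp.fourierTransformₗᵢ R4 ℂ).symm.norm_map _
  rw [← ofReal_norm, ← ofReal_norm, h]

/-- The Fourier transform of `P_k f` is a square integrable function supported where `|ξ - k| ≤ R`. The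
compact support of `ψ` absorbs the Sobolev weight, whatever the order `s`. -/
lemma exists_fourier_unitProj_eq {R : ℝ} {ψ : R4 → ℝ} (hψ : ContDiff ℝ ∞ ψ)
    (hsupp : tsupport ψ ⊆ Metric.closedBall 0 R) {s : ℝ} {f : 𝓢'(R4, ℂ)}
    (hf : TemperedDistribution.MemSobolev s 2 f) (k : Fin 4 → ℤ) :
    ∃ (φ : R4 → ℂ) (hφ : MemLp φ 2),
      𝓕 (unitProj ψ k f) = ((hφ.toLp φ : Lp ℂ 2 (volume : Measure R4)) : 𝓢'(R4, ℂ)) ∧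
      ∀ η, φ η ≠ 0 → ‖(2 * Real.pi) • η - latticePoint k‖ ≤ R := by
  obtain ⟨f', hf'⟩ := TemperedDistribution.memSobolev_iff_exists_smulLeftCLM_fourier.1 hf
  set c : R4 → ℂ := fun η => (ψ ((2 * Real.pi) • η - latticePoint k) : ℂ) with hc
  have hcs : HasCompactSupport ψ :=
    HasCompactSupport.of_support_subset_isCompact (isCompact_closedBall 0 R)
      ((subset_tsupport ψ).trans hsupp)
  have hccs : HasCompactSupport c := by
    have h2 : (2 * Real.pi) ≠ 0 := by positivity
    have := hcs.comp_homeomorph ((Homeomorph.smulOfNeZero (2 * Real.pi) h2 (α := R4)).trans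
      (Homeomorph.subRight (latticePoint k)))
    exact this.comp_left (g := fun r : ℝ => (r : ℂ)) (by simp)
  have hcd : ContDiff ℝ ∞ c := by
    have h : ContDiff ℝ ∞ fun η : R4 => ψ ((2 * Real.pi) • η - latticePoint k) :=
      hψ.comp (by fun_prop)
    exact Complex.ofRealCLM.contDiff.comp h
  have hct : Function.HasTemperateGrowth c := hccs.hasTemperateGrowth hcd
  set b : ℝ → R4 → ℂ := fun r η => (((1 + ‖η‖ ^ 2) ^ (r / 2) : ℝ) : ℂ) with hb
  have hbt : ∀ r, Function.HasTemperateGrowth (b r) := fun r => by simp only [hb]; fun_prop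
  have hbc : Function.HasTemperateGrowth (b (-s) * c) := (hbt _).mul hct
  have hmem : MemLp (b (-s) * c) ∞ (volume : Measure R4) := by
    refine (hbc.1.continuous).memLp_top_of_hasCompactSupport ?_ _
    exact hccs.mul_left
  have hfour : 𝓕 (unitProj ψ k f) =
      ((hmem.toLp _ • f' : Lp ℂ 2 (volume : Measure R4)) : 𝓢'(R4, ℂ)) := by
    rw [MeasureTheory.Lp.toTemperedDistribution_smul_eq hbc, ← hf',
      TemperedDistribution.smulLeftCLM_smulLeftCLM_apply (hbt s) hbc, unitProj, freqMultiplier,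
      TemperedDistribution.fourierMultiplierCLM_apply, FourierTransform.fourier_fourierInv_eq]
    congr 2
    funext η
    simp only [hb, hc, Pi.mul_apply]
    rw [← mul_assoc, ← Complex.ofReal_mul, ← Real.rpow_add (by positivity)]
    simp [neg_div]
  have hprod : (hmem.toLp _ • f' : Lp ℂ 2 (volume : Measure R4)) =ᵐ[volume]
      fun η => (b (-s) η * c η) * f' η := by
    filter_upwards [Lp.coeFn_lpSMul (r := 2) (hmem.toLp _) f', hmem.coeFn_toLp] with η h h'
    rw [h, Pi.smul_apply', h']
    rfl
  have hφ : MemLp (fun η => (b (-s) η * c η) * f' η) 2 := (memLp_congr_ae hprod).1 (Lp.memLp _)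
  refine ⟨_, hφ, ?_, fun η hη => ?_⟩
  · rw [hfour]
    congr 1
    exact Lp.ext (hprod.trans hφ.coeFn_toLp.symm)
  · have h1 : ψ ((2 * Real.pi) • η - latticePoint k) ≠ 0 := by
      intro h0
      apply hη
      simp [hc, h0]
    simpa using hsupp (subset_tsupport ψ h1)

/-- The propagator acts on the Fourier side by multiplication of functions. -/
lemma schrodinger_eq_fourierInv {T : 𝓢'(R4, ℂ)} {φ : R4 → ℂ} (hφ : MemLp φ 2)
    (hT : 𝓕 T = ((hφ.toLp φ : Lp ℂ 2 (volume : Measure R4)) : 𝓢'(R4, ℂ))) (t : ℝ)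
    (hφt : MemLp (fun η => schrodingerSymbol t η * φ η) 2) :
    schrodinger t T = 𝓕⁻ ((hφt.toLp _ : Lp ℂ 2 (volume : Measure R4)) : 𝓢'(R4, ℂ)) := by
  have hs := hasTemperateGrowth_schrodingerSymbol t
  have hmem : MemLp (schrodingerSymbol t) ∞ (volume : Measure R4) :=
    memLp_top_of_bound hs.1.continuous.aestronglyMeasurable 1
      (Filter.Eventually.of_forall fun η => (norm_schrodingerSymbol t η).le)
  have h1 : (hmem.toLp _ • hφ.toLp φ : Lp ℂ 2 (volume : Measure R4)) = hφt.toLp _ := by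
    refine Lp.ext ?_
    filter_upwards [Lp.coeFn_lpSMul (r := 2) (hmem.toLp _) (hφ.toLp φ), hmem.coeFn_toLp,
      hφ.coeFn_toLp, hφt.coeFn_toLp] with η h h' h'' h'''
    rw [h, Pi.smul_apply', h', h'', h''', smul_eq_mul]
  rw [← h1, MeasureTheory.Lp.toTemperedDistribution_smul_eq hs, ← hT]
  rfl

/-! ### The lateral maximal function -/

lemma inner_lateralPoint (e : OrthonormalBasis (Fin 4) ℝ R4) (ℓ : Fin 4) (y : ℝ)
    (z : Fin 3 → ℝ) : inner ℝ (lateralPoint e ℓ y z) (e ℓ) = y := by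
  have h : ∀ j : Fin 3, inner ℝ (e (ℓ.succAbove j)) (e ℓ) = (0 : ℝ) := fun j =>
    e.orthonormal.2 (Fin.succAbove_ne ℓ j)
  simp [lateralPoint, inner_add_left, sum_inner, real_inner_smul_left, h]

lemma lintegral_ofReal_inv_one_add_sq {κ : ℝ} (hκ : 0 < κ) (y : ℝ) :
    ∫⁻ y', ENNReal.ofReal (1 + ((y - y') / κ) ^ 2)⁻¹ = ENNReal.ofReal (Real.pi * κ) := by
  have h1 : Integrable fun y' : ℝ => (1 + ((y - y') / κ) ^ 2)⁻¹ :=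
    (integrable_inv_one_add_sq.comp_div hκ.ne').comp_sub_left y
  rw [← ofReal_integral_eq_lintegral_ofReal h1
    (Filter.Eventually.of_forall fun y' => by positivity)]
  congr 1
  rw [integral_sub_left_eq_self (fun x : ℝ => (1 + (x / κ) ^ 2)⁻¹) volume y,
    Measure.integral_comp_div (fun x : ℝ => (1 + x ^ 2)⁻¹) κ, integral_univ_inv_one_add_sq,
    abs_of_pos hκ, smul_eq_mul, mul_comm]

/-- The maximal estimate for superpositions of wave packets, with the constant `√(π |k|)`. -/
lemma lateralNorm_inner_wavePacket_le (e : OrthonormalBasis (Fin 4) ℝ R4) (ℓ : Fin 4) {k : R4}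
    (hk : 1 ≤ ‖k‖) (Φ : Lp ℂ 2 (volume : Measure R4)) :
    lateralNorm e ℓ 2 ∞ Set.univ (fun t x => inner ℂ (wavePacket k (t, x)) Φ) ≤
      ENNReal.ofReal (Real.pi * ‖k‖) ^ (1 / 2 : ℝ) * ‖Φ‖ₑ := by
  obtain ⟨w, hw⟩ := TopologicalSpace.exists_dense_seq (ℝ × (Fin 3 → ℝ))
  set p : ℕ → ℝ → ℝ × R4 := fun n y => ((w n).1, lateralPoint e ℓ y (w n).2) with hp
  have hlat : Continuous fun q : ℝ × (Fin 3 → ℝ) => lateralPoint e ℓ q.1 q.2 := by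
    unfold lateralPoint
    fun_prop
  have hpm : ∀ n, Measurable (p n) := fun n => by
    have : Continuous (p n) :=
      continuous_const.prodMk (hlat.comp (Continuous.prodMk_left _))
    exact this.measurable
  have hmain := lintegral_iSup_enorm_inner_sq_le (μ := (volume : Measure ℝ))
    (continuous_wavePacket k) (fun p => (norm_wavePacket k p).le) hpm
    (q := fun y y' => ENNReal.ofReal (1 + ((y - y') / ‖k‖) ^ 2)⁻¹) (fun m n y y' => by
      rw [inner_wavePacket_wavePacket, ← ofReal_norm]
      refine ENNReal.ofReal_le_ofReal ?_
      have h := norm_gaussianKernel_le_of_inner (e.orthonormal.1 ℓ) hk le_rfl (p m y - p n y')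
      simpa [hp, inner_sub_left, inner_lateralPoint] using h)
    (fun y => (lintegral_ofReal_inv_one_add_sq (by linarith) y).le) Φ
  -- by continuity in `(t, z)` the supremum over the dense sequence dominates every value
  have hsup : ∀ y, eLpNorm (fun v : ℝ × (Fin 3 → ℝ) =>
      inner ℂ (wavePacket k (v.1, lateralPoint e ℓ y v.2)) Φ) ∞
        (((volume : Measure ℝ).restrict Set.univ).prod volume) ^ 2 ≤
      ⨆ n, ‖inner ℂ (wavePacket k (p n y)) Φ‖ₑ ^ 2 := by
    intro y
    rw [eLpNorm_exponent_top]
    have hc : Continuous fun v : ℝ × (Fin 3 → ℝ) =>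
        ‖inner ℂ (wavePacket k (v.1, lateralPoint e ℓ y v.2)) Φ‖ₑ ^ 2 := by
      have h1 : Continuous fun v : ℝ × (Fin 3 → ℝ) => (v.1, lateralPoint e ℓ y v.2) :=
        continuous_fst.prodMk (hlat.comp (continuous_const.prodMk continuous_snd))
      have h2 := ((continuous_wavePacket k).comp h1).inner (𝕜 := ℂ)
        (continuous_const (y := Φ))
      exact (ENNReal.continuous_pow 2).comp h2.enorm
    have hall : ∀ v : ℝ × (Fin 3 → ℝ),
        ‖inner ℂ (wavePacket k (v.1, lateralPoint e ℓ y v.2)) Φ‖ₑ ^ 2 ≤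
          ⨆ n, ‖inner ℂ (wavePacket k (p n y)) Φ‖ₑ ^ 2 := by
      have hcl := isClosed_le hc (continuous_const
        (y := ⨆ n, ‖inner ℂ (wavePacket k (p n y)) Φ‖ₑ ^ 2))
      intro v
      have hsub : Set.range w ⊆ {v : ℝ × (Fin 3 → ℝ) |
          ‖inner ℂ (wavePacket k (v.1, lateralPoint e ℓ y v.2)) Φ‖ₑ ^ 2 ≤
            ⨆ n, ‖inner ℂ (wavePacket k (p n y)) Φ‖ₑ ^ 2} := by
        rintro _ ⟨n, rfl⟩
        exact le_iSup (fun n => ‖inner ℂ (wavePacket k (p n y)) Φ‖ₑ ^ 2) n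
      exact hcl.closure_subset_iff.2 hsub (hw v)
    set c := ⨆ n, ‖inner ℂ (wavePacket k (p n y)) Φ‖ₑ ^ 2
    have hroot : eLpNormEssSup (fun v : ℝ × (Fin 3 → ℝ) =>
        inner ℂ (wavePacket k (v.1, lateralPoint e ℓ y v.2)) Φ)
        (((volume : Measure ℝ).restrict Set.univ).prod volume) ≤ c ^ (1 / 2 : ℝ) := by
      refine essSup_le_of_ae_le _ (Filter.Eventually.of_forall fun v => ?_)
      rw [one_div, ENNReal.le_rpow_inv_iff (by norm_num), ENNReal.rpow_two]
      exact hall v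
    calc _ ≤ (c ^ (1 / 2 : ℝ)) ^ 2 := by gcongr
      _ = c := by rw [← ENNReal.rpow_natCast, ← ENNReal.rpow_mul]; simp
  rw [lateralNorm, eLpNorm_eq_lintegral_rpow_enorm_toReal (by norm_num) (by norm_num)]
  simp only [ENNReal.toReal_ofNat, enorm_eq_self]
  have hle : ∫⁻ y, eLpNorm (fun v : ℝ × (Fin 3 → ℝ) =>
      inner ℂ (wavePacket k (v.1, lateralPoint e ℓ y v.2)) Φ) ∞
        (((volume : Measure ℝ).restrict Set.univ).prod volume) ^ (2 : ℝ) ≤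
      ENNReal.ofReal (Real.pi * ‖k‖) * ‖Φ‖ₑ ^ 2 := by
    refine (lintegral_mono fun y => ?_).trans hmain
    rw [ENNReal.rpow_two]
    exact hsup y
  calc _ ≤ (ENNReal.ofReal (Real.pi * ‖k‖) * ‖Φ‖ₑ ^ 2) ^ (1 / 2 : ℝ) := by gcongr
    _ = _ := by
      rw [ENNReal.mul_rpow_of_nonneg _ _ (by norm_num), ← ENNReal.rpow_natCast,
        ← ENNReal.rpow_mul]
      simp

/-- Dividing by the weight costs only `exp (R² / 2)` on the ball where `φ` lives. -/
lemma exists_lp_eq_freqGaussian_mul {R : ℝ} {k : R4} {φ : R4 → ℂ} (hφ : MemLp φ 2)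
    (hsupp : ∀ η, φ η ≠ 0 → ‖(2 * Real.pi) • η - k‖ ≤ R) :
    ∃ Φ : Lp ℂ 2 (volume : Measure R4), (φ =ᵐ[volume] fun η => freqGaussian k η * Φ η) ∧
      ‖Φ‖ₑ ≤ ENNReal.ofReal (Real.exp (R ^ 2 / 2)) * eLpNorm φ 2 volume := by
  have hpos : ∀ η, 0 < freqGaussian k η := fun η => Real.exp_pos _
  have hcont : Continuous fun η => ((freqGaussian k η)⁻¹ : ℝ) :=
    (continuous_freqGaussian k).inv₀ fun η => (hpos η).ne'
  have hmeas : AEStronglyMeasurable (fun η => (((freqGaussian k η)⁻¹ : ℝ) : ℂ) * φ η) volume :=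
    (Complex.continuous_ofReal.comp hcont).aestronglyMeasurable.mul hφ.1
  have hbd : ∀ η, ‖(((freqGaussian k η)⁻¹ : ℝ) : ℂ) * φ η‖ ≤ Real.exp (R ^ 2 / 2) * ‖φ η‖ := by
    intro η
    by_cases h : φ η = 0
    · simp [h]
    rw [norm_mul, Complex.norm_real, Real.norm_of_nonneg (inv_nonneg.2 (hpos η).le)]
    gcongr
    rw [freqGaussian, ← Real.exp_neg]
    gcongr
    rw [neg_div, neg_neg]
    gcongr
    exact hsupp η h
  have hmem : MemLp (fun η => (((freqGaussian k η)⁻¹ : ℝ) : ℂ) * φ η) 2 :=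
    hφ.of_le_mul hmeas (Filter.Eventually.of_forall hbd)
  refine ⟨hmem.toLp _, ?_, ?_⟩
  · filter_upwards [hmem.coeFn_toLp] with η h
    rw [h, ← mul_assoc, ← Complex.ofReal_mul, mul_inv_cancel₀ (hpos η).ne']
    simp
  · rw [Lp.enorm_def, eLpNorm_congr_ae hmem.coeFn_toLp]
    exact eLpNorm_le_mul_eLpNorm_of_ae_le_mul (Filter.Eventually.of_forall hbd) 2

lemma integrable_freqGaussian_mul (k : R4) (Φ : Lp ℂ 2 (volume : Measure R4)) :
    Integrable fun η => (freqGaussian k η : ℂ) * Φ η := by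
  have h : MemLp (fun η => (freqGaussian k η : ℂ)) 2 (volume : Measure R4) := by
    convert memLp_wavePacketFun k 0 using 2 with η
    simp [wavePacketFun, schrodingerPhase]
  exact h.integrable_mul (Lp.memLp Φ)

/-- The evolution of `𝓕⁻¹ φ`, as an integral, is a pairing with wave packets. -/
lemma fourierInv_schrodingerSymbol_mul {k : R4} {φ : R4 → ℂ} {Φ : Lp ℂ 2 (volume : Measure R4)}
    (h : φ =ᵐ[volume] fun η => freqGaussian k η * Φ η) (t : ℝ) (x : R4) :
    𝓕⁻ (fun η => schrodingerSymbol t η * φ η) x = inner ℂ (wavePacket k (t, x)) Φ := by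
  rw [inner_wavePacket_eq_integral, Real.fourierInv_eq']
  refine integral_congr_ae ?_
  filter_upwards [h] with η hη
  rw [hη, smul_eq_mul, ← mul_assoc, schrodingerSymbol, ← Complex.exp_add]
  congr 2
  simp only [schrodingerPhase, real_inner_smul_right]
  rw [real_inner_comm]
  push_cast
  ring

theorem lemma5p4 (R : ℝ) :
    ∃ C : ℝ, 1 ≤ C ∧
      ∀ (ψ : R4 → ℝ), ContDiff ℝ ∞ ψ → tsupport ψ ⊆ Metric.closedBall 0 R →
      ∀ (e : OrthonormalBasis (Fin 4) ℝ R4) (s : ℝ) (f : 𝓢'(R4, ℂ)),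
        TemperedDistribution.MemSobolev s 2 f →
      ∀ k : Fin 4 → ℤ, 10 ≤ ‖latticePoint k‖ →
      ∃ (g : R4 → ℂ) (u : ℝ → R4 → ℂ),
        IsL2Function (unitProj ψ k f) g ∧
        Continuous (fun x : ℝ × R4 => u x.1 x.2) ∧
        (∀ t : ℝ, IsL2Function (schrodinger t (unitProj ψ k f)) (u t)) ∧
        ∀ ℓ : Fin 4,
          lateralNorm e ℓ 2 ∞ Set.univ u ≤
            ENNReal.ofReal (C * ‖latticePoint k‖ ^ (1 / 2 : ℝ)) * eLpNorm g 2 volume := by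
  -- `2` bounds `√π` from `lateralNorm_inner_wavePacket_le`; the exponential comes from dividing by
  -- the Gaussian weight
  refine ⟨2 * Real.exp (R ^ 2 / 2), ?_, fun ψ hψ hsupp e s f hf k hk => ?_⟩
  · have := Real.one_le_exp (show 0 ≤ R ^ 2 / 2 by positivity)
    linarith
  obtain ⟨φ, hφ, hfour, hφs⟩ := exists_fourier_unitProj_eq hψ hsupp hf k
  obtain ⟨Φ, hΦ, hΦn⟩ := exists_lp_eq_freqGaussian_mul hφ hφs
  have hint : Integrable φ := (integrable_freqGaussian_mul _ Φ).congr hΦ.symm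
  have hsm : ∀ t, AEStronglyMeasurable (schrodingerSymbol t) (volume : Measure R4) := fun t =>
    (hasTemperateGrowth_schrodingerSymbol t).1.continuous.aestronglyMeasurable
  have hφt : ∀ t, MemLp (fun η => schrodingerSymbol t η * φ η) 2 := fun t =>
    hφ.of_le ((hsm t).mul hφ.1) (Filter.Eventually.of_forall fun η => by
      rw [norm_mul, norm_schrodingerSymbol, one_mul])
  have hintt : ∀ t, Integrable fun η => schrodingerSymbol t η * φ η := fun t =>
    hint.mono ((hsm t).mul hφ.1) (Filter.Eventually.of_forall fun η => by
      rw [norm_mul, norm_schrodingerSymbol, one_mul])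
  have hu : ∀ t, 𝓕⁻ (fun η => schrodingerSymbol t η * φ η) =
      fun x => inner ℂ (wavePacket (latticePoint k) (t, x)) Φ := fun t =>
    funext (fourierInv_schrodingerSymbol_mul hΦ t)
  refine ⟨𝓕⁻ φ, fun t x => inner ℂ (wavePacket (latticePoint k) (t, x)) Φ, ?_, ?_, ?_, ?_⟩
  · have h := isL2Function_fourierInv hint hφ
    rwa [← hfour, FourierTransform.fourierInv_fourier_eq] at h
  · exact (continuous_wavePacket _).inner continuous_const
  · intro t
    have h := isL2Function_fourierInv (hintt t) (hφt t)
    rwa [← schrodinger_eq_fourierInv hφ hfour t (hφt t), hu t] at h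
  · intro ℓ
    refine (lateralNorm_inner_wavePacket_le e ℓ (by linarith) Φ).trans ?_
    rw [eLpNorm_fourierInv hint hφ]
    set κ := ‖latticePoint k‖
    have hκ : 0 ≤ κ := norm_nonneg _
    calc _ ≤ ENNReal.ofReal (Real.pi * κ) ^ (1 / 2 : ℝ) *
          (ENNReal.ofReal (Real.exp (R ^ 2 / 2)) * eLpNorm φ 2 volume) := by gcongr
      _ = ENNReal.ofReal ((Real.pi * κ) ^ (1 / 2 : ℝ) * Real.exp (R ^ 2 / 2)) *
          eLpNorm φ 2 volume := by
        rw [ENNReal.ofReal_rpow_of_nonneg (by positivity) (by norm_num),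
          ENNReal.ofReal_mul (by positivity), mul_assoc]
      _ ≤ _ := by
        gcongr ENNReal.ofReal ?_ * _
        rw [Real.mul_rpow Real.pi_pos.le hκ]
        have h2 : Real.pi ^ (1 / 2 : ℝ) ≤ 2 := by
          rw [← Real.sqrt_eq_rpow]
          exact (Real.sqrt_le_sqrt Real.pi_le_four).trans_eq (by
            rw [show (4 : ℝ) = 2 ^ 2 by norm_num, Real.sqrt_sq (by norm_num)])
        calc Real.pi ^ (1 / 2 : ℝ) * κ ^ (1 / 2 : ℝ) * Real.exp (R ^ 2 / 2)
            ≤ 2 * κ ^ (1 / 2 : ℝ) * Real.exp (R ^ 2 / 2) := by gcongr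
          _ = _ := by ring
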